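/- **Theorem.** Let $\mathcal{A}$ be a unital $C^*$-algebra, faithfully represented on a Hilbert space $\mathcal{H}$ by a unital injective $*$-homomorphism $\pi\colon\mathcal{A}\to\mathcal{B}(\mathcal{H})$. Let $U$ be a strongly continuous unitary representation of a (real, finite-dimensional) Lie group $G$ in $\mathcal{A}$, that is, a homomorphism from $G$ to the group of unitary elements of $\mathcal{A}$ such that $g\mapsto\pi(U(g))v$ is continuous for every $v\in\mathcal{H}$ (this holds for instance whenever $U$ is norm continuous). Assume that $U$ separates states: if $\rho_1\neq\rho_2$ are states of $\mathcal{A}$, then $\rho_1(U(g))\neq\rho_2(U(g))$ for some $g\in G$. Here a state is a linear functional $\rho$ on $\mathcal{A}$ with $\rho(\mathbb{1})=1$ and $\rho(a^*a)\ge 0$ for all $a\in\mathcal{A}$. Let $\rho\colon\mathcal{A}\to\mathbb{C}$ be a continuous linear functional with smeared character $\chi_\rho(g)=\rho(U(g))$, $g\in G$. Then $\rho$ is a state if and only if $\chi_\rho(e)=1$ and $\chi_\rho$ is of positive type on $G$, that is, $$\sum_{i,j=1}^N\overline{\xi_i}\,\xi_j\,\chi_\rho(g_i^{-1}g_j)\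 \ge\ 0\qquad\text{for all } N\in\mathbb{N},\ \xi_1,\dots,\xi_N\in\mathbb{C},\ g_1,\dots,g_N\in G.$$ -/

import Mathlib

open scoped ContDiff ComplexOrder Manifold

/-- A state on a unital C*-algebra: a normalized positive linear functional.  (The order on `ℂ` is
the usual partial one, so `0 ≤ z` says that `z` is real and non-negative.) -/
structure IsState {A : Type*} [CStarAlgebra A] (ρ : A →L[ℂ] ℂ) : Prop where
  map_one : ρ 1 = 1
  map_star_mul_self_nonneg : ∀ a : A, 0 ≤ ρ (star a * a)

/-- The sampling function `x ↦ ⟨ρ, U x⟩` of a functional `ρ` with respect to a map `U`. -/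
noncomputable def samplingFunction {A X : Type*} [CStarAlgebra A] (U : X → A) (ρ : A →L[ℂ] ℂ) : X → ℂ :=
  fun x => ρ (U x)

/-- `U` separates states: two different states have different sampling functions. -/
def SeparatesStates {A X : Type*} [CStarAlgebra A] (U : X → A) : Prop :=
  ∀ ρ σ : A →L[ℂ] ℂ, IsState ρ → IsState σ → ρ ≠ σ →
    ∃ x : X, samplingFunction U ρ x ≠ samplingFunction U σ x

/-- A homomorphism `U` of `G` into the unitary group of `A` is strongly continuous, where `A` acts
on a Hilbert space `H` through `π`: all the maps `g ↦ π (U g) v` are norm continuous.  Norm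
continuity of `U` implies this for every `π`. -/
def IsStronglyContinuous {G A H : Type*} [Group G] [TopologicalSpace G] [CStarAlgebra A]
    [NormedAddCommGroup H] [InnerProductSpace ℂ H] [CompleteSpace H]
    (π : A →⋆ₐ[ℂ] (H →L[ℂ] H)) (U : G →* unitary A) : Prop :=
  ∀ v : H, Continuous fun g : G => π (U g : A) v

/-- The smeared character `χ_ρ g = ⟨ρ, U g⟩`: the sampling function of `ρ` with respect to a
unitary representation `U` of `G` in `A`. -/
noncomputable def smearedCharacter {G A : Type*} [Group G] [CStarAlgebra A]
    (U : G →* unitary A) (ρ : A →L[ℂ] ℂ) : G → ℂ :=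
  samplingFunction (fun g : G => (U g : A)) ρ

/-- Functions of positive type (positive semidefinite functions) on a group. -/
def IsPositiveType {G : Type*} [Group G] (χ : G → ℂ) : Prop :=
  ∀ (N : ℕ) (ξ : Fin N → ℂ) (g : Fin N → G),
    0 ≤ ∑ i, ∑ j, star (ξ i) * ξ j * χ ((g i)⁻¹ * g j)

/-!
The linear span of the unitaries `U g` is a unital `*`-subalgebra of `A`, and positivity of `ρ` on
elements `star b * b` with `b` in this span is precisely positivity of type of the smeared
character (`map_star_mul_self_sum`). The claim thus reduces to norm density of the span: by
continuity of `ρ`, non-negativity of `ρ (star b * b)` then propagates to all of `A`.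

Density (`dense_span_of_separatesStates`) is a Hahn-Banach argument. A continuous functional that
vanishes on the span has real and imaginary parts which, restricted to the self-adjoint elements,
vanish on all `ℜ (U g)` and `ℑ (U g)`. Such a real functional `f` is a difference of two positive
functionals (`exists_nonneg_sub_eq`), which take the same value at `1`, hence after normalization
are states with the same sampling function. These agree because `U` separates states, so `f = 0`.

The decomposition into positive functionals comes from M. Riesz's extension theorem on
`selfAdjoint A × selfAdjoint A` with the product of the positive cones: a pair `(φ, ψ)` of positive
functionals with `φ - ψ = f` is the same as a positive functional on the product with prescribed
values at the pairs `(a, -a)`.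
-/

open Complex
open scoped ComplexStarModule

/-! ### Positive functionals on the self-adjoint part -/

section Order

variable {A : Type*} [CStarAlgebra A] [PartialOrder A] [StarOrderedRing A]

/-- Every bounded real functional on the self-adjoint part is a difference of two positive ones
(the functional is taken to be `2 * f`, which avoids halves in the values at the pairs `(a, -a)`).
The decomposition is not the minimal (Jordan) one: a slack in the norms makes the sum of the two
parts strictly positive at `1`, which spares the case of zero functionals when normalizing. -/
lemma exists_nonneg_sub_eq [Nontrivial A] (f : selfAdjoint A →L[ℝ] ℝ) :
    ∃ φ ψ : selfAdjoint A →ₗ[ℝ] ℝ, (∀ a : selfAdjoint A, 0 ≤ (a : A) → 0 ≤ φ a) ∧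
      (∀ a : selfAdjoint A, 0 ≤ (a : A) → 0 ≤ ψ a) ∧ (∀ a, φ a - ψ a = 2 * f a) ∧
      0 < φ 1 + ψ 1 := by
  obtain ⟨τ, hτ⟩ : ∃ τ : selfAdjoint A →L[ℝ] ℝ, τ 1 = 1 := by
    have h1 : ‖(1 : selfAdjoint A)‖ = 1 := CStarRing.norm_one (E := A)
    obtain ⟨τ, -, hτ⟩ := exists_dual_vector ℝ (1 : selfAdjoint A) (by simp [h1])
    exact ⟨τ, by simpa [h1] using hτ⟩
  let C : PointedCone ℝ (selfAdjoint A × selfAdjoint A) :=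
    { carrier := {p | 0 ≤ (p.1 : A) ∧ 0 ≤ (p.2 : A)}
      add_mem' := fun ha hb => ⟨by simpa using add_nonneg ha.1 hb.1,
        by simpa using add_nonneg ha.2 hb.2⟩
      zero_mem' := by simp
      smul_mem' := fun c x hx => ⟨smul_nonneg (show (0 : ℝ) ≤ c from c.2) hx.1,
        smul_nonneg (show (0 : ℝ) ≤ c from c.2) hx.2⟩ }
  -- The pairs `(a, -a)` are enlarged by the order unit `(1, 1)`, so that the subspace is cofinal.
  let D : Submodule ℝ (selfAdjoint A × selfAdjoint A) :=
    (Submodule.span ℝ {(1 : selfAdjoint A)}).comap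
      (LinearMap.fst ℝ (selfAdjoint A) (selfAdjoint A) + LinearMap.snd ℝ _ _)
  let F : selfAdjoint A × selfAdjoint A →ₗ[ℝ] ℝ :=
    f.toLinearMap ∘ₗ (LinearMap.fst ℝ (selfAdjoint A) (selfAdjoint A) - LinearMap.snd ℝ _ _) +
      (2 * ‖f‖ + 1) • τ.toLinearMap ∘ₗ
        (LinearMap.fst ℝ (selfAdjoint A) (selfAdjoint A) + LinearMap.snd ℝ _ _)
  have hF (x y) : F (x, y) = f (x - y) + (2 * ‖f‖ + 1) * τ (x + y) := rfl
  have hD (x y) : (x, y) ∈ D ↔ ∃ t : ℝ, t • (1 : selfAdjoint A) = x + y :=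
    Submodule.mem_span_singleton
  obtain ⟨g, hg, hgC⟩ := riesz_extension C (F.toPMap D) (by
      rintro ⟨⟨x, y⟩, hxy⟩ ⟨hx : 0 ≤ (x : A), hy : 0 ≤ (y : A)⟩
      change 0 ≤ F (x, y)
      obtain ⟨t, ht⟩ := (hD x y).1 hxy
      have htA : algebraMap ℝ A t = x + y := by
        simpa [Algebra.algebraMap_eq_smul_one] using congrArg (Subtype.val) ht
      have ht0 : 0 ≤ t := by
        have h := spectrum_nonneg_of_nonneg (htA ▸ add_nonneg hx hy : 0 ≤ algebraMap ℝ A t)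
          (x := t)
        exact h (by simp)
      have hn : ‖algebraMap ℝ A t‖ = t := by simp [abs_of_nonneg ht0]
      have hxn : ‖x‖ ≤ t := hn ▸ CStarAlgebra.norm_le_norm_of_nonneg_of_le hx
        (by rw [htA]; exact le_add_of_nonneg_right hy)
      have hyn : ‖y‖ ≤ t := hn ▸ CStarAlgebra.norm_le_norm_of_nonneg_of_le hy
        (by rw [htA]; exact le_add_of_nonneg_left hx)
      have hfn : |f (x - y)| ≤ ‖f‖ * (2 * t) := (f.le_opNorm _).trans
        (mul_le_mul_of_nonneg_left ((norm_sub_le x y).trans (by linarith)) (norm_nonneg f))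
      rw [hF, ← ht, map_smul, hτ, smul_eq_mul]
      linarith [neg_le_of_abs_le hfn]) (by
      rintro ⟨x, y⟩
      refine ⟨⟨(‖x‖ + ‖y‖) • (1, 1), D.smul_mem _ ((hD 1 1).2 ⟨2, two_smul ℝ _⟩)⟩, ?_⟩
      have key (a : selfAdjoint A) (r : ℝ) (hr : ‖a‖ ≤ r) :
          0 ≤ ((r • 1 + a : selfAdjoint A) : A) := by
        have h1 := IsSelfAdjoint.neg_algebraMap_norm_le_self a.2
        have h2 : algebraMap ℝ A ‖(a : A)‖ ≤ algebraMap ℝ A r := algebraMap_mono A hr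
        have h3 := add_nonneg (neg_le_iff_add_nonneg.1 h1) (sub_nonneg.2 h2)
        have h4 : ((r • 1 + a : selfAdjoint A) : A) =
            (a : A) + algebraMap ℝ A ‖(a : A)‖ + (algebraMap ℝ A r - algebraMap ℝ A ‖(a : A)‖) := by
          simp [Algebra.algebraMap_eq_smul_one, add_comm]
        rwa [h4]
      exact ⟨key x _ (by simp), key y _ (by simp)⟩)
  have hgF (x y) (h : ∃ t : ℝ, t • (1 : selfAdjoint A) = x + y) : g (x, y) = F (x, y) :=
    hg ⟨(x, y), (hD x y).2 h⟩
  refine ⟨g ∘ₗ LinearMap.inl ℝ _ _, g ∘ₗ LinearMap.inr ℝ _ _, fun a ha => hgC _ ⟨ha, le_rfl⟩,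
    fun a ha => hgC _ ⟨le_rfl, ha⟩, fun a => ?_, ?_⟩
  · have h := hgF a (-a) ⟨0, by simp⟩
    rw [hF, add_neg_cancel, map_zero, mul_zero, add_zero, sub_neg_eq_add, map_add] at h
    simp only [LinearMap.comp_apply, LinearMap.inl_apply, LinearMap.inr_apply]
    rw [← map_sub, Prod.mk_sub_mk, sub_zero, zero_sub, h, two_mul]
  · have h := hgF 1 1 ⟨2, two_smul ℝ _⟩
    rw [hF, sub_self, map_zero, zero_add, map_add, hτ] at h
    simp only [LinearMap.comp_apply, LinearMap.inl_apply, LinearMap.inr_apply]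
    rw [← map_add, Prod.mk_add_mk, add_zero, zero_add, h]
    positivity

/-- A normalized positive functional on the self-adjoint part is automatically bounded, and its
complexification is a state. -/
lemma exists_isState_of_nonneg (φ : selfAdjoint A →ₗ[ℝ] ℝ)
    (hφ : ∀ a : selfAdjoint A, 0 ≤ (a : A) → 0 ≤ φ a) (h1 : φ 1 = 1) :
    ∃ ρ : A →L[ℂ] ℂ, IsState ρ ∧ ∀ a : A, ρ a = φ (ℜ a) + I * φ (ℑ a) := by
  have hle (a : selfAdjoint A) : φ a ≤ ‖a‖ := by
    have h := hφ (‖a‖ • 1 - a) (by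
      simpa [Algebra.algebraMap_eq_smul_one] using IsSelfAdjoint.le_algebraMap_norm_self a.2)
    rw [map_sub, map_smul, h1, smul_eq_mul, mul_one] at h
    linarith
  -- Only `φ ∘ ℜ` has to be bounded: it determines the complexification, as `ℜ (I • a) = -ℑ a`.
  have hre (a : A) : |φ (ℜ a)| ≤ 1 * ‖a‖ := by
    rw [one_mul]
    refine le_trans (abs_le'.2 ⟨hle _, ?_⟩) (realPart.norm_le a)
    simpa using hle (-ℜ a)
  let r : StrongDual ℝ A := (φ ∘ₗ realPart).mkContinuous 1 hre
  have hr (a : A) : r a = φ (ℜ a) := rfl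
  have hρ (a : A) : (r.extendRCLike : StrongDual ℂ A) a = φ (ℜ a) + I * φ (ℑ a) := by
    rw [StrongDual.extendRCLike_apply, hr, hr]
    simp [realPart_I_smul]
  refine ⟨r.extendRCLike, ⟨?_, fun a => ?_⟩, hρ⟩
  · simp [hρ, h1, (IsSelfAdjoint.one A).imaginaryPart]
  · have hs : IsSelfAdjoint (star a * a) := .star_mul_self a
    rw [hρ, hs.imaginaryPart, map_zero, ofReal_zero, mul_zero, add_zero, zero_le_real]
    exact hφ _ (by rw [hs.coe_realPart]; exact star_mul_self_nonneg a)

end Order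

/-! ### Density of the span of a state-separating family -/

section Density

variable {A X : Type*} [CStarAlgebra A]

/-- If `1` is among the values of a state-separating `U`, then the values of `U`, together with
their adjoints, separate the bounded real functionals on the self-adjoint part from zero. -/
lemma eq_zero_of_realPart_imaginaryPart_eq_zero {U : X → A} (hsep : SeparatesStates U)
    (x₁ : X) (hx₁ : U x₁ = 1) (f : selfAdjoint A →L[ℝ] ℝ)
    (hre : ∀ x, f (ℜ (U x)) = 0) (him : ∀ x, f (ℑ (U x)) = 0) : f = 0 := by
  let _ := CStarAlgebra.spectralOrder A
  have _ := CStarAlgebra.spectralOrderedRing A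
  rcases subsingleton_or_nontrivial A with _ | _
  · exact Subsingleton.elim _ _
  obtain ⟨φ, ψ, hφ, hψ, hf, hpos⟩ := exists_nonneg_sub_eq f
  have h1 : f 1 = 0 := by simpa [hx₁] using hre x₁
  have hc : ψ 1 = φ 1 := by linarith [hf 1]
  have hc0 : 0 < φ 1 := by linarith
  have hnn (θ : selfAdjoint A →ₗ[ℝ] ℝ) (hθ : ∀ a : selfAdjoint A, 0 ≤ (a : A) → 0 ≤ θ a)
      (a : selfAdjoint A) (ha : 0 ≤ (a : A)) : 0 ≤ ((φ 1)⁻¹ • θ) a :=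
    mul_nonneg (inv_nonneg.2 hc0.le) (hθ a ha)
  obtain ⟨ρ, hρ, hρφ⟩ := exists_isState_of_nonneg ((φ 1)⁻¹ • φ) (hnn φ hφ)
    (by simp [hc0.ne'])
  obtain ⟨σ, hσ, hσψ⟩ := exists_isState_of_nonneg ((φ 1)⁻¹ • ψ) (hnn ψ hψ)
    (by simp [hc, hc0.ne'])
  have hρσ : ρ = σ := by
    by_contra hne
    obtain ⟨x, hx⟩ := hsep ρ σ hρ hσ hne
    have h2 : φ (ℜ (U x)) = ψ (ℜ (U x)) := by linarith [hf (ℜ (U x)), hre x]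
    have h3 : φ (ℑ (U x)) = ψ (ℑ (U x)) := by linarith [hf (ℑ (U x)), him x]
    exact hx (by simp [samplingFunction, hρφ, hσψ, h2, h3])
  ext a
  have h := DFunLike.congr_fun hρσ (a : A)
  rw [hρφ, hσψ, a.2.imaginaryPart] at h
  simp only [map_zero, ofReal_zero, mul_zero, add_zero, ofReal_inj, LinearMap.smul_apply,
    smul_eq_mul, selfAdjoint.realPart_coe] at h
  have h' := mul_left_cancel₀ (inv_ne_zero hc0.ne') h
  have := hf a
  simp only [zero_apply]
  linarith

/-- A form of the Hahn-Banach theorem: functionals on the quotient by the closure of `p` separate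
points, and they pull back to functionals vanishing on `p`. -/
lemma Submodule.dense_of_forall_dual_eq_zero {E : Type*} [NormedAddCommGroup E] [NormedSpace ℂ E]
    (p : Submodule ℂ E) (h : ∀ f : E →L[ℂ] ℂ, (∀ x ∈ p, f x = 0) → f = 0) :
    Dense (p : Set E) := by
  rw [Submodule.dense_iff_topologicalClosure_eq_top, Submodule.eq_top_iff']
  intro x
  have hcl : IsClosed (p.topologicalClosure : Set E) := p.isClosed_topologicalClosure
  rw [← Submodule.Quotient.mk_eq_zero]
  refine SeparatingDual.eq_zero_of_forall_dual_eq_zero (R := ℂ) fun f => ?_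
  have := h (f ∘L p.topologicalClosure.mkQL) fun y hy => by
    have : (Submodule.Quotient.mk y : E ⧸ p.topologicalClosure) = 0 :=
      (Submodule.Quotient.mk_eq_zero _).2 (p.le_topologicalClosure hy)
    change f (Submodule.Quotient.mk y) = 0
    rw [this, map_zero]
  exact DFunLike.congr_fun this x

lemma dense_span_of_separatesStates {U : X → A} (hsep : SeparatesStates U)
    (x₁ : X) (hx₁ : U x₁ = 1) (hstar : ∀ x, ∃ y, U y = star (U x)) :
    Dense (Submodule.span ℂ (Set.range U) : Set A) := by
  refine Submodule.dense_of_forall_dual_eq_zero _ fun f hf => ?_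
  have hU (x) : f (U x) = 0 := hf _ (Submodule.subset_span ⟨x, rfl⟩)
  have hre (x) : f (ℜ (U x)) = 0 := by
    obtain ⟨y, hy⟩ := hstar x
    rw [realPart_apply_coe, ← hy, ← Complex.coe_smul, map_smul, map_add, hU, hU]
    simp
  have him (x) : f (ℑ (U x)) = 0 := by
    have h := hU x
    rw [← realPart_add_I_smul_imaginaryPart (U x), map_add, hre, map_smul, zero_add] at h
    exact (smul_eq_zero.1 h).resolve_left I_ne_zero
  let ι : selfAdjoint A →L[ℝ] A := ⟨(selfAdjoint.submodule ℝ A).subtype, continuous_subtype_val⟩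
  let fre : selfAdjoint A →L[ℝ] ℝ := reCLM ∘L f.restrictScalars ℝ ∘L ι
  let fim : selfAdjoint A →L[ℝ] ℝ := imCLM ∘L f.restrictScalars ℝ ∘L ι
  have h1 : fre = 0 := eq_zero_of_realPart_imaginaryPart_eq_zero hsep x₁ hx₁ fre
    (fun x => congrArg re (hre x)) (fun x => congrArg re (him x))
  have h2 : fim = 0 := eq_zero_of_realPart_imaginaryPart_eq_zero hsep x₁ hx₁ fim
    (fun x => congrArg im (hre x)) (fun x => congrArg im (him x))
  have h (a : selfAdjoint A) : f a = 0 :=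
    Complex.ext (DFunLike.congr_fun h1 a) (DFunLike.congr_fun h2 a)
  ext a
  rw [← realPart_add_I_smul_imaginaryPart a, map_add, map_smul, h, h]
  simp

end Density

/-! ### States and functions of positive type -/

lemma map_star_mul_self_sum {G A : Type*} [Group G] [CStarAlgebra A] (U : G →* unitary A)
    (ρ : A →L[ℂ] ℂ) {N : ℕ} (ξ : Fin N → ℂ) (g : Fin N → G) :
    ρ (star (∑ i, ξ i • (U (g i) : A)) * ∑ i, ξ i • (U (g i) : A)) =
      ∑ i, ∑ j, star (ξ i) * ξ j * smearedCharacter U ρ ((g i)⁻¹ * g j) := by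
  simp only [star_sum, star_smul, Finset.sum_mul_sum, map_sum, smul_mul_smul_comm, map_smul,
    smul_eq_mul, smearedCharacter, samplingFunction, map_mul, map_inv, Submonoid.coe_mul,
    ← Unitary.star_eq_inv, Unitary.coe_star]

theorem mainTheorem2
    {E : Type*} [NormedAddCommGroup E] [NormedSpace ℝ E] [FiniteDimensional ℝ E]
    {G : Type*} [Group G] [TopologicalSpace G] [ChartedSpace E G] [LieGroup 𝓘(ℝ, E) ∞ G]
    {A : Type*} [CStarAlgebra A]
    {H : Type*} [NormedAddCommGroup H] [InnerProductSpace ℂ H] [CompleteSpace H]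
    (π : A →⋆ₐ[ℂ] (H →L[ℂ] H)) (hπ : Function.Injective π)
    (U : G →* unitary A) (hU : IsStronglyContinuous π U)
    (hsep : SeparatesStates fun g : G => (U g : A))
    (ρ : A →L[ℂ] ℂ) :
    IsState ρ ↔ IsPositiveType (smearedCharacter U ρ) ∧ smearedCharacter U ρ 1 = 1 := by
  have hone : smearedCharacter U ρ 1 = ρ 1 := by simp [smearedCharacter, samplingFunction]
  refine ⟨fun h => ⟨fun N ξ g => ?_, hone.trans h.map_one⟩,
    fun ⟨hpos, h1⟩ => ⟨hone.symm.trans h1, fun a => ?_⟩⟩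
  · rw [← map_star_mul_self_sum]
    exact h.map_star_mul_self_nonneg _
  · have hdense := dense_span_of_separatesStates hsep 1 (by simp) fun g => ⟨g⁻¹, by
      rw [map_inv, ← Unitary.star_eq_inv, Unitary.coe_star]⟩
    refine hdense.induction (P := fun a => 0 ≤ ρ (star a * a)) (fun b hb => ?_)
      (isClosed_Ici.preimage (f := fun a => ρ (star a * a)) (by fun_prop)) a
    obtain ⟨N, ξ, v, rfl⟩ := Submodule.mem_span_set'.1 hb
    choose g hg using fun i => (v i).2
    simp only [← hg]
    rw [map_star_mul_self_sum]
    exact hpos N ξ g
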